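/- Let $G$ be an abelian group (for instance $\mathbb Z^{r}\times\mathbb Z/c_1\mathbb Z\times\cdots\times\mathbb Z/c_h\mathbb Z$), let $a_1,\dots,a_n\in G$ be nonzero, and let $S=\langle a_1,\dots,a_n\rangle=\{\sum_i\alpha_i a_i:\alpha\in\mathbb N^n\}$ satisfy $S\cap(-S)=\{0\}$. Let $\Bbbk$ be a field. The $S$-degree of a monomial $X^\alpha$ in $\Bbbk[X_1,\dots,X_n]$ is $\sum_i\alpha_i a_i$. The ideal of $S$ is $$I_S=\big\langle X^\alpha-X^\beta:\ \textstyle\sum_i\alpha_ia_i=\sum_i\beta_ia_i\big\rangle\subset\Bbbk[X_1,\dots,X_n].$$ For $B\subseteq\{a_1,\dots,a_n\}$ let $\Bbbk[B]$ be the polynomial subring in the indeterminates $X_i$ with $a_i\in B$, and let $I_{\langle B\rangle}\subset\Bbbk[B]$ be the ideal of the semigroup $\langle B\rangle$, defined in the same way. $S$ is called decomposable if there are $t\ge 2$ subsets $A_1,\dots,A_t$ of $\{a_1,\dots,a_n\}$ such that the $S_i=\langle A_i\rangle$ are proper subsemigroups of $S$, $S=S_1\oplus\cdots\oplus S_t$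 (every element of $S$ is uniquely a sum $s_1+\dots+s_t$ with $s_i\in S_i$), $I_S=I_{S_1}+\cdots+I_{S_t}$ (the $I_{S_i}$ being extended to $\Bbbk[X_1,\dots,X_n]$), and $I_{S_i}\neq 0$ for every $i$. For $m\in S$ let $$\Delta_m=\Big\{F\subseteq\{1,\dots,n\}:\ m-\sum_{i\in F}a_i\in S\Big\},\qquad \nabla_m=\big\{F\subseteq\{\text{monomials of }S\text{-degree }m\}:\ \gcd(F)\ne1\big\}.$$ These are simplicial complexes; such a complex is called not connected if it has at least two connected components (so a complex without vertices is not among them). The following are equivalent. 1. $S$ is decomposable. 2. There are disjoint proper subsets $C_1,C_2$ of $\{a_1,\dots,a_n\}$ with $\{a_1,\dots,a_n\}=C_1\sqcup C_2$ such that: for every $m\in S$ with $\nabla_m$ not connected, either all vertices of $\nabla_m$ belong to $\Bbbk[C_1]$ or all of them belong to $\Bbbk[C_2]$; and there are $m_1,m_2\in S$ with $\nabla_{m_1}$ and $\nabla_{m_2}$ not connected such that the vertices of $\nabla_{m_1}$ belong to $\Bbbk[C_1]$ and the vertices of $\nabla_{m_2}$ belong to $\Bbbk[C_2]$. 3. There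 are disjoint proper subsets $C_1,C_2$ of $\{1,\dots,n\}$ with $\{1,\dots,n\}=C_1\sqcup C_2$ such that: for every $m\in S$ with $\Delta_m$ not connected, either all vertices of $\Delta_m$ belong to $C_1$ or all of them belong to $C_2$; and there are $m_1,m_2\in S$ with $\Delta_{m_1}$ and $\Delta_{m_2}$ not connected such that the vertices of $\Delta_{m_1}$ belong to $C_1$ and the vertices of $\Delta_{m_2}$ belong to $C_2$. -/

import Mathlib

/-!
Semigroups `S = ⟨a₁, …, aₙ⟩` (with zero) in an abelian group are given by the family
`a : Fin n → G` of their generators, so that `S = AddSubmonoid.closure (Set.range a)`.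
Monomials `X ^ α` are written through their exponents `α : σ →₀ ℕ`.
-/

/-- The `S`-degree `∑ αᵢ aᵢ` of the monomial `X ^ α`. -/
noncomputable def sDegree {σ G : Type*} [AddCommGroup G] (a : σ → G) (α : σ →₀ ℕ) : G :=
  α.sum fun i c => c • a i

/-- The ideal `I_S` of the semigroup generated by the family `a`: it is generated by all binomials
`X ^ α - X ^ β` whose two monomials have the same `S`-degree. -/
noncomputable def semigroupIdeal (k : Type*) {σ G : Type*} [Field k] [AddCommGroup G]
    (a : σ → G) : Ideal (MvPolynomial σ k) :=
  Ideal.span {p | ∃ α β : σ →₀ ℕ, sDegree a α = sDegree a β ∧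
    p = MvPolynomial.monomial α (1 : k) - MvPolynomial.monomial β (1 : k)}

/-- The indeterminates of `k[B]`, for a set `B` of generators, are the `Xᵢ` with `aᵢ ∈ B`.
This is the ideal `I_⟨B⟩` of the semigroup `⟨B⟩`, inside `k[B]`. -/
noncomputable def subsemigroupIdeal (k : Type*) {σ G : Type*} [Field k] [AddCommGroup G]
    (a : σ → G) (B : Set G) : Ideal (MvPolynomial {i : σ // a i ∈ B} k) :=
  semigroupIdeal k fun i : {i : σ // a i ∈ B} => a i

/-- `I_⟨B⟩` as an ideal of the whole polynomial ring: the extension along `k[B] ⊆ k[X₁, …, Xₙ]`. -/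
noncomputable def extendedSubsemigroupIdeal (k : Type*) {σ G : Type*} [Field k] [AddCommGroup G]
    (a : σ → G) (B : Set G) : Ideal (MvPolynomial σ k) :=
  (subsemigroupIdeal k a B).map
    (MvPolynomial.rename (R := k) (Subtype.val : {i : σ // a i ∈ B} → σ))

/-- `S = ⟨a₁, …, aₙ⟩` is decomposable: there are `t ≥ 2` sets `A₁, …, A_t` of generators such
that the `Sᵢ = ⟨Aᵢ⟩` are proper subsemigroups, `S` is their direct sum (each element of `S` is in
exactly one way a sum of elements of the `Sᵢ`), `I_S = I_{S₁} + ⋯ + I_{S_t}`, and each summand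
contributes to this decomposition of the ideal, that is, `I_{Sᵢ} ≠ 0`. -/
def IsDecomposable (k : Type*) {σ G : Type*} [Field k] [AddCommGroup G] (a : σ → G) : Prop :=
  ∃ (t : ℕ) (A : Fin t → Set G), 2 ≤ t ∧
    (∀ i, A i ⊆ Set.range a) ∧
    (∀ i, AddSubmonoid.closure (A i) ≠ AddSubmonoid.closure (Set.range a)) ∧
    (∀ x ∈ AddSubmonoid.closure (Set.range a),
      ∃! s : Fin t → G, (∀ i, s i ∈ AddSubmonoid.closure (A i)) ∧ ∑ i, s i = x) ∧
    semigroupIdeal k a = ⨆ i, extendedSubsemigroupIdeal k a (A i) ∧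
    (∀ i, subsemigroupIdeal k a (A i) ≠ ⊥)

/-- The complex `∇_m`: its faces are the finite nonempty sets of monomials of `S`-degree `m` whose
greatest common divisor is not `1`. In terms of exponents the greatest common divisor is the
componentwise minimum, and the monomial `1` has exponent `0`. (The empty face is left out, as
always in `PreAbstractSimplicialComplex`.) -/
noncomputable def nablaComplex {σ G : Type*} [AddCommGroup G] (a : σ → G) (m : G) :
    PreAbstractSimplicialComplex (σ →₀ ℕ) where
  faces := {F | (∀ α ∈ F, sDegree a α = m) ∧ ∃ h : F.Nonempty, F.inf' h id ≠ 0}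
  isRelLowerSet_faces := by
    rintro F ⟨hF, hne, hgcd⟩
    refine ⟨hne, fun F' hsub hne' => ⟨fun α hα => hF α (hsub hα), hne', fun h0 => hgcd ?_⟩⟩
    exact le_antisymm (h0 ▸ Finset.inf'_mono id hsub hne') zero_le

/-- The complex `Δ_m` on the index set: its faces are the nonempty sets `F` of indices with
`m - ∑_{i ∈ F} aᵢ ∈ S`. -/
def deltaComplex {σ G : Type*} [AddCommGroup G] (a : σ → G) (m : G) :
    PreAbstractSimplicialComplex σ where
  faces := {F | F.Nonempty ∧ m - ∑ i ∈ F, a i ∈ AddSubmonoid.closure (Set.range a)}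
  isRelLowerSet_faces := by
    classical
    rintro F ⟨hne, hF⟩
    refine ⟨hne, fun F' hsub hne' => ⟨hne', ?_⟩⟩
    have h : m - ∑ i ∈ F', a i = (m - ∑ i ∈ F, a i) + ∑ i ∈ F \ F', a i := by
      rw [← Finset.sum_sdiff hsub]
      abel
    rw [h]
    exact add_mem hF (sum_mem fun i _ => AddSubmonoid.subset_closure ⟨i, rfl⟩)

/-- The vertices of a simplicial complex. -/
def complexVertices {V : Type*} (K : PreAbstractSimplicialComplex V) : Set V :=
  {v | {v} ∈ K.faces}

/-- A simplicial complex is connected if any two of its vertices are joined by a path in which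
consecutive vertices lie in a common face. It is not connected exactly when it has at least two
connected components; a complex without vertices is not counted among these. -/
def IsConnectedComplex {V : Type*} (K : PreAbstractSimplicialComplex V) : Prop :=
  ∀ v ∈ complexVertices K, ∀ w ∈ complexVertices K,
    Relation.ReflTransGen (fun x y => ∃ F ∈ K.faces, x ∈ F ∧ y ∈ F) v w

/-- All vertices of `∇_m` belong to `k[C]`, the subring generated over `k` by the `Xᵢ` with
`aᵢ ∈ C`. -/
def NablaVerticesIn (k : Type*) {σ G : Type*} [Field k] [AddCommGroup G] (a : σ → G) (m : G)
    (C : Set G) : Prop :=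
  ∀ α ∈ complexVertices (nablaComplex a m),
    MvPolynomial.monomial α (1 : k) ∈ MvPolynomial.supported k {i | a i ∈ C}

/-!
By the ascending chain condition on principal ideals of `S`, which holds for finitely generated `S`,
all relations among the generators come from degrees `m` with `∇_m` disconnected: two monomials in a
common face have a common factor, and cancelling it lowers the degree. Moreover `∇_m` and `Δ_m` are
the two sides of the bipartite incidence graph between the monomials of degree `m` and the
indeterminates, so they are connected simultaneously.

Suppose that `S` is the direct sum of the semigroups generated by the `aᵢ` with `i ∈ P` and by the
remaining `aᵢ`. If a degree involves both kinds of indeterminates, then exchanging the `P`-parts of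
two monomials of this degree gives a mixed monomial that connects them, so a disconnected degree
involves only one kind. Conversely, if no disconnected degree involves both kinds, every relation
follows from relations on one side, so the degree of the `P`-part is determined by the total degree.
-/

open Finsupp (supported single)

section ACCP

variable {G : Type*} [AddCommGroup G]

/-- The ascending chain condition on the principal ideals `x + S` of the semigroup `S`: there is no
infinite strictly ascending chain of them with `x ∈ S`. The strict inclusion `y + S ⊂ x + S` is
written as `y - x ∈ S ∧ x - y ∉ S`. -/
def SatisfiesACCP (S : AddSubmonoid G) : Prop :=
  (S : Set G).WellFoundedOn fun x y => y - x ∈ S ∧ x - y ∉ S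

theorem satisfiesACCP_of_fg {S : AddSubmonoid G} (hS : S.FG) : SatisfiesACCP S := by
  obtain ⟨s, rfl, hs⟩ := (AddSubmonoid.fg_iff S).1 hS
  have := hs.to_subtype
  have : IsPreorder G fun x y => y - x ∈ AddSubmonoid.closure s :=
    { refl := fun x => by simp
      trans := fun x y z hxy hyz => by simpa using add_mem hyz hxy }
  have dickson : (Set.univ : Set (s →₀ ℕ)).PartiallyWellOrderedOn (· ≤ ·) :=
    Set.partiallyWellOrderedOn_univ_iff.2 wellQuasiOrdered_le
  have himage := dickson.image_of_monotone_on
    (f := Finsupp.linearCombination ℕ (Subtype.val : s → G))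
    (r' := fun x y => y - x ∈ AddSubmonoid.closure s) ?_
  · refine (himage.mono fun x hx => ?_).wellFoundedOn
    rw [← Submodule.span_nat_eq_addSubmonoidClosure] at hx
    simpa using (Finsupp.mem_span_iff_linearCombination ℕ s x).1 hx
  · rintro α - _ - hle
    obtain ⟨γ, rfl⟩ := exists_add_of_le hle
    rw [map_add, add_sub_cancel_left]
    exact sum_mem fun i _ => nsmul_mem (AddSubmonoid.subset_closure i.2) _

end ACCP

section SDegree

variable {σ G : Type*} [AddCommGroup G] {a : σ → G}

theorem coe_linearCombination_eq_sDegree (a : σ → G) :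
    ⇑(Finsupp.linearCombination ℕ a) = sDegree a :=
  rfl

theorem sDegree_zero (a : σ → G) : sDegree a 0 = 0 :=
  map_zero (Finsupp.linearCombination ℕ a)

theorem sDegree_add (a : σ → G) (α β : σ →₀ ℕ) :
    sDegree a (α + β) = sDegree a α + sDegree a β :=
  map_add (Finsupp.linearCombination ℕ a) α β

theorem sDegree_single_one (a : σ → G) (i : σ) : sDegree a (single i 1) = a i := by
  simp [← coe_linearCombination_eq_sDegree]

theorem sDegree_mapDomain {τ : Type*} (f : τ → σ) (a : σ → G) (α : τ →₀ ℕ) :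
    sDegree a (α.mapDomain f) = sDegree (fun i => a (f i)) α :=
  Finsupp.linearCombination_mapDomain ℕ f α

theorem mem_closure_image_iff {P : Set σ} {x : G} :
    x ∈ AddSubmonoid.closure (a '' P) ↔ ∃ α ∈ supported ℕ ℕ P, sDegree a α = x := by
  rw [← Submodule.span_nat_eq_addSubmonoidClosure]
  exact Finsupp.mem_span_image_iff_linearCombination ℕ

theorem mem_closure_range_iff {x : G} :
    x ∈ AddSubmonoid.closure (Set.range a) ↔ ∃ α : σ →₀ ℕ, sDegree a α = x := by
  simp [← Set.image_univ, mem_closure_image_iff]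

theorem sDegree_mem_closure_range (a : σ → G) (α : σ →₀ ℕ) :
    sDegree a α ∈ AddSubmonoid.closure (Set.range a) :=
  mem_closure_range_iff.2 ⟨α, rfl⟩

theorem exists_eq_single_one_add {α : σ →₀ ℕ} {i : σ} (hi : i ∈ α.support) :
    ∃ β : σ →₀ ℕ, α = single i 1 + β :=
  exists_add_of_le <| Finsupp.single_le_iff.2 <|
    Nat.one_le_iff_ne_zero.2 (Finsupp.mem_support_iff.1 hi)

theorem eq_zero_of_sDegree_eq_zero (ha : ∀ i, a i ≠ 0)
    (hS : ∀ x ∈ AddSubmonoid.closure (Set.range a),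
      -x ∈ AddSubmonoid.closure (Set.range a) → x = 0)
    {α : σ →₀ ℕ} (h : sDegree a α = 0) : α = 0 := by
  by_contra hα
  obtain ⟨i, hi⟩ := Finsupp.support_nonempty_iff.2 hα
  obtain ⟨β, rfl⟩ := exists_eq_single_one_add hi
  rw [sDegree_add, sDegree_single_one] at h
  refine ha i (hS _ (AddSubmonoid.subset_closure ⟨i, rfl⟩) ?_)
  rw [neg_eq_of_add_eq_zero_right h]
  exact sDegree_mem_closure_range a β

theorem exists_add_eq_of_supported_compl (P : Set σ) (α : σ →₀ ℕ) :
    ∃ α₁ ∈ supported ℕ ℕ P, ∃ α₂ ∈ supported ℕ ℕ Pᶜ, α₁ + α₂ = α :=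
  Submodule.codisjoint_iff_exists_add_eq.1
    (Finsupp.codisjoint_supported_supported isCompl_compl.codisjoint) α |>.imp
    fun _ ⟨α₂, h₁, h₂, h⟩ => ⟨h₁, α₂, h₂, h⟩

end SDegree

section Complexes

variable {σ G : Type*} [AddCommGroup G] {a : σ → G} {m : G}

open Relation (ReflTransGen Comp)

theorem mem_complexVertices_nablaComplex {α : σ →₀ ℕ} :
    α ∈ complexVertices (nablaComplex a m) ↔ sDegree a α = m ∧ α ≠ 0 := by
  simp [complexVertices, nablaComplex]

theorem exists_mem_faces_nablaComplex_iff {α β : σ →₀ ℕ} :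
    (∃ F ∈ (nablaComplex a m).faces, α ∈ F ∧ β ∈ F) ↔
      sDegree a α = m ∧ sDegree a β = m ∧ ∃ i, i ∈ α.support ∧ i ∈ β.support := by
  classical
  constructor
  · rintro ⟨F, ⟨hF, hne, hgcd⟩, hα, hβ⟩
    obtain ⟨i, hi⟩ := Finsupp.support_nonempty_iff.2 hgcd
    exact ⟨hF α hα, hF β hβ, i, Finsupp.support_mono (Finset.inf'_le id hα) hi,
      Finsupp.support_mono (Finset.inf'_le id hβ) hi⟩
  · rintro ⟨hα, hβ, i, hi⟩
    refine ⟨{α, β}, ⟨by simp [hα, hβ], by simp, ?_⟩, by simp, by simp⟩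
    rw [← Finsupp.support_nonempty_iff]
    exact ⟨i, by simpa [Nat.min_eq_zero_iff] using hi⟩

theorem mem_faces_deltaComplex {F : Finset σ} :
    F ∈ (deltaComplex a m).faces ↔
      F.Nonempty ∧ ∃ α : σ →₀ ℕ, sDegree a α = m ∧ F ⊆ α.support := by
  classical
  set π : σ →₀ ℕ := ∑ i ∈ F, single i 1 with hπ
  have hdeg : sDegree a π = ∑ i ∈ F, a i := by
    simp [hπ, ← coe_linearCombination_eq_sDegree]
  have hle (α : σ →₀ ℕ) : π ≤ α ↔ F ⊆ α.support := by
    simp only [Finsupp.le_def, Finset.subset_iff, Finsupp.mem_support_iff]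
    refine forall_congr' fun i => ?_
    by_cases hi : i ∈ F <;> simp [hπ, Finsupp.single_apply, hi, Nat.one_le_iff_ne_zero]
  refine and_congr_right fun _ => ?_
  simp only [mem_closure_range_iff, ← hle, eq_sub_iff_add_eq, ← hdeg, ← sDegree_add]
  constructor
  · rintro ⟨β, hβ⟩
    exact ⟨β + π, hβ, le_add_self⟩
  · rintro ⟨α, hα, hπα⟩
    exact ⟨α - π, by rw [tsub_add_cancel_of_le hπα, hα]⟩

theorem mem_complexVertices_deltaComplex {i : σ} :
    i ∈ complexVertices (deltaComplex a m) ↔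
      ∃ α : σ →₀ ℕ, sDegree a α = m ∧ i ∈ α.support := by
  simp [complexVertices, mem_faces_deltaComplex]

theorem exists_mem_faces_deltaComplex_iff {i j : σ} :
    (∃ F ∈ (deltaComplex a m).faces, i ∈ F ∧ j ∈ F) ↔
      ∃ α : σ →₀ ℕ, sDegree a α = m ∧ i ∈ α.support ∧ j ∈ α.support := by
  classical
  simp only [mem_faces_deltaComplex]
  constructor
  · rintro ⟨F, ⟨-, α, hα, hF⟩, hi, hj⟩
    exact ⟨α, hα, hF hi, hF hj⟩
  · rintro ⟨α, hα, hij⟩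
    exact ⟨{i, j}, ⟨by simp, α, hα, by simpa [Finset.insert_subset_iff] using hij⟩,
      by simp, by simp⟩

/-- Connectedness of the left-hand side of the bipartite graph of a relation `R`: the non-isolated
points on the left are joined by paths that move to the right-hand side and back. -/
def LeftConnected {A B : Type*} (R : A → B → Prop) : Prop :=
  ∀ x, (∃ b, R x b) → ∀ y, (∃ b, R y b) → ReflTransGen (Comp R (flip R)) x y

theorem LeftConnected.flip {A B : Type*} {R : A → B → Prop} (h : LeftConnected R) :
    LeftConnected (flip R) := by
  rintro b ⟨x, hxb⟩ c ⟨y, hyc⟩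
  have hpath := h x ⟨b, hxb⟩ y ⟨c, hyc⟩
  induction hpath generalizing c with
  | refl => exact .single ⟨x, hxb, hyc⟩
  | tail _ hstep ih =>
    obtain ⟨d, hd, hd'⟩ := hstep
    exact (ih d hd).tail ⟨_, hd', hyc⟩

/-- The incidence relation between the monomials of `S`-degree `m` and the indeterminates. -/
def FiberIncidence (a : σ → G) (m : G) (α : σ →₀ ℕ) (i : σ) : Prop :=
  sDegree a α = m ∧ i ∈ α.support

theorem isConnectedComplex_nablaComplex_iff :
    IsConnectedComplex (nablaComplex a m) ↔ LeftConnected (FiberIncidence a m) := by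
  have hadj (α β : σ →₀ ℕ) : (∃ F ∈ (nablaComplex a m).faces, α ∈ F ∧ β ∈ F) ↔
      Comp (FiberIncidence a m) (flip (FiberIncidence a m)) α β := by
    simp only [exists_mem_faces_nablaComplex_iff, Comp, flip, FiberIncidence]
    tauto
  have hvertex (α : σ →₀ ℕ) :
      α ∈ complexVertices (nablaComplex a m) ↔ ∃ i, FiberIncidence a m α i := by
    simp [mem_complexVertices_nablaComplex, FiberIncidence, Finsupp.ne_iff]
  simp only [IsConnectedComplex, LeftConnected, hvertex, hadj]

theorem isConnectedComplex_deltaComplex_iff :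
    IsConnectedComplex (deltaComplex a m) ↔ LeftConnected (flip (FiberIncidence a m)) := by
  have hadj (i j : σ) : (∃ F ∈ (deltaComplex a m).faces, i ∈ F ∧ j ∈ F) ↔
      Comp (flip (FiberIncidence a m)) (FiberIncidence a m) i j := by
    simp only [exists_mem_faces_deltaComplex_iff, Comp, flip, FiberIncidence]
    tauto
  have hvertex (i : σ) :
      i ∈ complexVertices (deltaComplex a m) ↔ ∃ α, FiberIncidence a m α i :=
    mem_complexVertices_deltaComplex
  simp only [IsConnectedComplex, hvertex, hadj]
  rfl

theorem isConnectedComplex_nablaComplex_iff_deltaComplex :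
    IsConnectedComplex (nablaComplex a m) ↔ IsConnectedComplex (deltaComplex a m) := by
  rw [isConnectedComplex_nablaComplex_iff, isConnectedComplex_deltaComplex_iff]
  exact ⟨LeftConnected.flip, LeftConnected.flip⟩

/-- All monomials of `S`-degree `m` only involve indeterminates with index in `P`; this is the
common form of the conditions on the vertices of `∇_m` and `Δ_m`. -/
def FiberSupportedIn (a : σ → G) (m : G) (P : Set σ) : Prop :=
  ∀ α : σ →₀ ℕ, sDegree a α = m → α ∈ supported ℕ ℕ P

theorem nablaVerticesIn_iff {k : Type*} [Field k] {C : Set G} :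
    NablaVerticesIn k a m C ↔ FiberSupportedIn a m (a ⁻¹' C) := by
  simp only [NablaVerticesIn, mem_complexVertices_nablaComplex, MvPolynomial.mem_supported,
    MvPolynomial.vars_monomial (one_ne_zero : (1 : k) ≠ 0), FiberSupportedIn]
  refine forall_congr' fun α => ⟨fun h hα => ?_, fun h hα => h hα.1⟩
  obtain rfl | hα0 := eq_or_ne α 0
  · exact zero_mem _
  · exact h ⟨hα, hα0⟩

theorem complexVertices_deltaComplex_subset_iff {P : Set σ} :
    complexVertices (deltaComplex a m) ⊆ P ↔ FiberSupportedIn a m P := by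
  simp only [Set.subset_def, mem_complexVertices_deltaComplex, FiberSupportedIn,
    Finsupp.mem_supported, Finset.mem_coe]
  exact ⟨fun h α hα i hi => h i ⟨α, hα, hi⟩, fun h i ⟨α, hα, hi⟩ => h α hα i hi⟩

theorem exists_ne_of_not_isConnectedComplex (hm : ¬ IsConnectedComplex (nablaComplex a m)) :
    ∃ α β : σ →₀ ℕ, α ≠ β ∧ sDegree a α = m ∧ sDegree a β = m := by
  by_contra! hunique
  refine hm fun α hα β hβ => ?_
  rw [mem_complexVertices_nablaComplex] at hα hβ
  obtain rfl : α = β := by_contra fun hne => hunique α β hne hα.1 hβ.1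
  exact .refl

/-- The combinatorial form of the fact that `I_S` is generated by binomials in the degrees `m` with
`∇_m` disconnected. -/
theorem addCon_of_sDegree_eq (ha : ∀ i, a i ≠ 0)
    (hS : ∀ x ∈ AddSubmonoid.closure (Set.range a),
      -x ∈ AddSubmonoid.closure (Set.range a) → x = 0)
    (hacc : SatisfiesACCP (AddSubmonoid.closure (Set.range a))) {c : AddCon (σ →₀ ℕ)}
    (hc : ∀ α β, ¬ IsConnectedComplex (nablaComplex a (sDegree a α)) →
      sDegree a α = sDegree a β → c α β)
    {α β : σ →₀ ℕ} (hαβ : sDegree a α = sDegree a β) : c α β := by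
  suffices ∀ m ∈ AddSubmonoid.closure (Set.range a), ∀ α β : σ →₀ ℕ,
      sDegree a α = m → sDegree a β = m → c α β from
    this _ (sDegree_mem_closure_range a α) α β rfl hαβ.symm
  refine fun m hm => hacc.induction (P := fun m => ∀ α β : σ →₀ ℕ,
    sDegree a α = m → sDegree a β = m → c α β) hm fun m _ ih α β hα hβ => ?_
  by_cases hconn : IsConnectedComplex (nablaComplex a m)
  swap
  · exact hc α β (hα ▸ hconn) (hα.trans hβ.symm)
  obtain rfl | hα0 := eq_or_ne α 0
  · rw [eq_zero_of_sDegree_eq_zero ha hS (hβ.trans (hα.symm.trans (sDegree_zero a)))]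
    exact c.refl 0
  obtain rfl | hβ0 := eq_or_ne β 0
  · exact absurd (eq_zero_of_sDegree_eq_zero ha hS
      (hα.trans (hβ.symm.trans (sDegree_zero a)))) hα0
  have hpath := hconn α (mem_complexVertices_nablaComplex.2 ⟨hα, hα0⟩) β
    (mem_complexVertices_nablaComplex.2 ⟨hβ, hβ0⟩)
  clear hβ hβ0
  induction hpath with
  | refl => exact c.refl α
  | tail _ hface ih_path =>
    refine c.trans ih_path ?_
    obtain ⟨hγ, hδ, i, hiγ, hiδ⟩ := exists_mem_faces_nablaComplex_iff.1 hface
    obtain ⟨γ, rfl⟩ := exists_eq_single_one_add hiγ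
    obtain ⟨δ, rfl⟩ := exists_eq_single_one_add hiδ
    rw [sDegree_add, sDegree_single_one] at hγ hδ
    have hi : a i ∈ AddSubmonoid.closure (Set.range a) := AddSubmonoid.subset_closure ⟨i, rfl⟩
    refine c.add (c.refl _) (ih (sDegree a γ) (sDegree_mem_closure_range a γ) ?_ γ δ rfl
      (add_left_cancel (hδ.trans hγ.symm)))
    rw [← hγ, add_sub_cancel_right, sub_add_cancel_right]
    exact ⟨hi, fun hneg => ha i (hS _ hi hneg)⟩

end Complexes

section Splitting

variable {σ G : Type*} [AddCommGroup G] {a : σ → G} {P : Set σ}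

theorem sDegree_indicator_add {α₁ α₂ : σ →₀ ℕ} (h₁ : α₁ ∈ supported ℕ ℕ P)
    (h₂ : α₂ ∈ supported ℕ ℕ Pᶜ) : sDegree (P.indicator a) (α₁ + α₂) = sDegree a α₁ := by
  have hP : sDegree (P.indicator a) α₁ = sDegree a α₁ :=
    Finsupp.sum_congr fun i hi => by rw [Set.indicator_of_mem (h₁ hi)]
  have hPc : sDegree (P.indicator a) α₂ = 0 :=
    Finset.sum_eq_zero fun i hi => by simp only [Set.indicator_of_notMem (h₂ hi), smul_zero]
  rw [sDegree_add, hP, hPc, add_zero]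

theorem sDegree_indicator_of_mem {α : σ →₀ ℕ} (hα : α ∈ supported ℕ ℕ P) :
    sDegree (P.indicator a) α = sDegree a α := by
  simpa using sDegree_indicator_add (a := a) hα (zero_mem _)

theorem sDegree_indicator_of_mem_compl {α : σ →₀ ℕ} (hα : α ∈ supported ℕ ℕ Pᶜ) :
    sDegree (P.indicator a) α = 0 := by
  simpa [sDegree_zero] using sDegree_indicator_add (a := a) (zero_mem _) hα

/-- The semigroup `S` is the direct sum of the subsemigroups generated by the `aᵢ` with `i ∈ P` and
by the remaining ones: the degree of a monomial determines the degree of its part in the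
indeterminates with index in `P`. That part of the degree is written with the family
`P.indicator a`, in which the other generators are replaced by `0`. -/
def SplitsAlong (a : σ → G) (P : Set σ) : Prop :=
  ∀ α β : σ →₀ ℕ, sDegree a α = sDegree a β →
    sDegree (P.indicator a) α = sDegree (P.indicator a) β

theorem SplitsAlong.sDegree_eq_and_eq (h : SplitsAlong a P) {α₁ α₂ β₁ β₂ : σ →₀ ℕ}
    (hα₁ : α₁ ∈ supported ℕ ℕ P) (hα₂ : α₂ ∈ supported ℕ ℕ Pᶜ)
    (hβ₁ : β₁ ∈ supported ℕ ℕ P) (hβ₂ : β₂ ∈ supported ℕ ℕ Pᶜ)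
    (hαβ : sDegree a (α₁ + α₂) = sDegree a (β₁ + β₂)) :
    sDegree a α₁ = sDegree a β₁ ∧ sDegree a α₂ = sDegree a β₂ := by
  have h₁ := h _ _ hαβ
  rw [sDegree_indicator_add hα₁ hα₂, sDegree_indicator_add hβ₁ hβ₂] at h₁
  rw [sDegree_add, sDegree_add, h₁] at hαβ
  exact ⟨h₁, add_left_cancel hαβ⟩

theorem SplitsAlong.compl (h : SplitsAlong a P) : SplitsAlong a Pᶜ := by
  intro α β hαβ
  obtain ⟨α₁, hα₁, α₂, hα₂, rfl⟩ := exists_add_eq_of_supported_compl P α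
  obtain ⟨β₁, hβ₁, β₂, hβ₂, rfl⟩ := exists_add_eq_of_supported_compl P β
  have h₂ := (h.sDegree_eq_and_eq hα₁ hα₂ hβ₁ hβ₂ hαβ).2
  rw [← compl_compl P] at hα₁ hβ₁
  rwa [add_comm α₁, add_comm β₁, sDegree_indicator_add hα₂ hα₁, sDegree_indicator_add hβ₂ hβ₁]

theorem SplitsAlong.mem_of_eq (h : SplitsAlong a P) (ha : ∀ i, a i ≠ 0) {i j : σ}
    (hij : a i = a j) (hi : i ∈ P) : j ∈ P := by
  by_contra hj
  have := h (single i 1) (single j 1) (by simpa only [sDegree_single_one] using hij)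
  rw [sDegree_single_one, sDegree_single_one, Set.indicator_of_mem hi,
    Set.indicator_of_notMem hj] at this
  exact ha i this

theorem SplitsAlong.preimage_image (h : SplitsAlong a P) (ha : ∀ i, a i ≠ 0) :
    a ⁻¹' (a '' P) = P := by
  refine (Set.subset_preimage_image a P).antisymm' ?_
  rintro j ⟨i, hi, hij⟩
  exact h.mem_of_eq ha hij hi

theorem SplitsAlong.fiberSupportedIn (h : SplitsAlong a P)
    (hpos : ∀ α : σ →₀ ℕ, sDegree a α = 0 → α = 0) {α : σ →₀ ℕ} (hα : α ∈ supported ℕ ℕ P) :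
    FiberSupportedIn a (sDegree a α) P := by
  intro β hβ
  obtain ⟨β₁, hβ₁, β₂, hβ₂, rfl⟩ := exists_add_eq_of_supported_compl P β
  have h₂ := (h.sDegree_eq_and_eq hβ₁ hβ₂ hα (zero_mem _) (by rwa [add_zero])).2
  rwa [hpos β₂ (h₂.trans (sDegree_zero a)), add_zero]

theorem SplitsAlong.fiberSupportedIn_or (h : SplitsAlong a P)
    (hpos : ∀ α : σ →₀ ℕ, sDegree a α = 0 → α = 0) {m : G}
    (hm : ¬ IsConnectedComplex (nablaComplex a m)) :
    FiberSupportedIn a m P ∨ FiberSupportedIn a m Pᶜ := by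
  by_contra! hnot
  refine hm fun α hα β hβ => ?_
  simp only [exists_mem_faces_nablaComplex_iff]
  obtain ⟨hα, -⟩ := mem_complexVertices_nablaComplex.1 hα
  obtain ⟨hβ, -⟩ := mem_complexVertices_nablaComplex.1 hβ
  obtain ⟨α₁, hα₁, α₂, hα₂, rfl⟩ := exists_add_eq_of_supported_compl P α
  obtain ⟨β₁, hβ₁, β₂, hβ₂, rfl⟩ := exists_add_eq_of_supported_compl P β
  have hdeg := (h.sDegree_eq_and_eq hα₁ hα₂ hβ₁ hβ₂ (hα.trans hβ.symm)).1
  have hα₁0 : α₁ ≠ 0 := by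
    rintro rfl
    rw [zero_add] at hα
    exact hnot.2 (hα ▸ h.compl.fiberSupportedIn hpos hα₂)
  have hβ₂0 : β₂ ≠ 0 := by
    rintro rfl
    rw [add_zero] at hβ
    exact hnot.1 (hβ ▸ h.fiberSupportedIn hpos hβ₁)
  obtain ⟨i, hi⟩ := Finsupp.support_nonempty_iff.2 hα₁0
  obtain ⟨j, hj⟩ := Finsupp.support_nonempty_iff.2 hβ₂0
  -- The mixed monomial `X ^ (α₁ + β₂)` joins `X ^ (α₁ + α₂)` to `X ^ (β₁ + β₂)`.
  have hmixed : sDegree a (α₁ + β₂) = m := by rw [← hβ, sDegree_add, sDegree_add, hdeg]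
  have hleft := Finsupp.support_mono (le_self_add : α₁ ≤ α₁ + α₂) hi
  have hleft' := Finsupp.support_mono (le_self_add : α₁ ≤ α₁ + β₂) hi
  have hright := Finsupp.support_mono (le_add_self : β₂ ≤ α₁ + β₂) hj
  have hright' := Finsupp.support_mono (le_add_self : β₂ ≤ β₁ + β₂) hj
  exact .tail (.single ⟨hα, hmixed, i, hleft, hleft'⟩) ⟨hmixed, hβ, j, hright, hright'⟩

theorem not_linearIndepOn_of_not_isConnectedComplex {m : G}
    (hm : ¬ IsConnectedComplex (nablaComplex a m)) (h : FiberSupportedIn a m P) :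
    ¬ LinearIndepOn ℕ a P := by
  obtain ⟨α, β, hne, hα, hβ⟩ := exists_ne_of_not_isConnectedComplex hm
  exact fun hP => hne (linearIndepOn_iffₛ.1 hP α (h α hα) β (h β hβ) (hα.trans hβ.symm))

/-- The index set `P` and its complement separate the degrees with disconnected complexes, and each
of them contains all indeterminates of such a degree. -/
def SeparatesDisconnected (a : σ → G) (P : Set σ) : Prop :=
  (∀ m ∈ AddSubmonoid.closure (Set.range a), ¬ IsConnectedComplex (nablaComplex a m) →
    FiberSupportedIn a m P ∨ FiberSupportedIn a m Pᶜ) ∧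
  ∃ m₁ ∈ AddSubmonoid.closure (Set.range a), ∃ m₂ ∈ AddSubmonoid.closure (Set.range a),
    ¬ IsConnectedComplex (nablaComplex a m₁) ∧ ¬ IsConnectedComplex (nablaComplex a m₂) ∧
    FiberSupportedIn a m₁ P ∧ FiberSupportedIn a m₂ Pᶜ

section ACCP

variable (ha : ∀ i, a i ≠ 0)
  (hS : ∀ x ∈ AddSubmonoid.closure (Set.range a),
    -x ∈ AddSubmonoid.closure (Set.range a) → x = 0)
  (hacc : SatisfiesACCP (AddSubmonoid.closure (Set.range a)))

include ha hS hacc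

theorem splitsAlong_of_fiberSupportedIn_or
    (h : ∀ m ∈ AddSubmonoid.closure (Set.range a), ¬ IsConnectedComplex (nablaComplex a m) →
      FiberSupportedIn a m P ∨ FiberSupportedIn a m Pᶜ) : SplitsAlong a P := by
  intro α β hαβ
  refine addCon_of_sDegree_eq ha hS hacc
    (c := AddCon.ker (Finsupp.linearCombination ℕ (P.indicator a))) (fun α β hm hαβ => ?_) hαβ
  rw [AddCon.ker_rel, coe_linearCombination_eq_sDegree]
  rcases h _ (sDegree_mem_closure_range a α) hm with h | h
  · rw [sDegree_indicator_of_mem (h α rfl), sDegree_indicator_of_mem (h β hαβ.symm), hαβ]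
  · rw [sDegree_indicator_of_mem_compl (h α rfl), sDegree_indicator_of_mem_compl (h β hαβ.symm)]

theorem SplitsAlong.exists_not_isConnectedComplex (h : SplitsAlong a P)
    (hP : ¬ LinearIndepOn ℕ a P) :
    ∃ m ∈ AddSubmonoid.closure (Set.range a), ¬ IsConnectedComplex (nablaComplex a m) ∧
      FiberSupportedIn a m P := by
  classical
  contrapose! hP with hnone
  refine linearIndepOn_iffₛ.2 fun α hα β hβ hαβ => ?_
  have hrestrict : α.filter (· ∈ P) = β.filter (· ∈ P) := by
    refine addCon_of_sDegree_eq ha hS hacc (c := AddCon.ker (Finsupp.filterAddHom (· ∈ P)))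
      (fun γ δ hm hγδ => ?_) hαβ
    have hPc := (h.fiberSupportedIn_or (fun _ => eq_zero_of_sDegree_eq_zero ha hS) hm).resolve_left
      (hnone _ (sDegree_mem_closure_range a γ) hm)
    have hzero {ε : σ →₀ ℕ} (hε : ε ∈ supported ℕ ℕ Pᶜ) : ε.filter (· ∈ P) = 0 := by
      refine Finsupp.filter_eq_zero_iff _ _ |>.2 fun i hi => ?_
      exact Finsupp.notMem_support_iff.1 fun hiε => hε hiε hi
    exact (hzero (hPc γ rfl)).trans (hzero (hPc δ hγδ.symm)).symm
  have hself {ε : σ →₀ ℕ} (hε : ε ∈ supported ℕ ℕ P) : ε.filter (· ∈ P) = ε :=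
    Finsupp.filter_eq_self_iff _ _ |>.2 fun i hi => hε (Finsupp.mem_support_iff.2 hi)
  rwa [hself hα, hself hβ] at hrestrict

theorem splitsAlong_and_iff_separatesDisconnected :
    SplitsAlong a P ∧ ¬ LinearIndepOn ℕ a P ∧ ¬ LinearIndepOn ℕ a Pᶜ ↔
      SeparatesDisconnected a P := by
  constructor
  · rintro ⟨h, hP, hPc⟩
    obtain ⟨m₁, hm₁, hc₁, hs₁⟩ := h.exists_not_isConnectedComplex ha hS hacc hP
    obtain ⟨m₂, hm₂, hc₂, hs₂⟩ := h.compl.exists_not_isConnectedComplex ha hS hacc hPc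
    exact ⟨fun m _ => h.fiberSupportedIn_or fun _ => eq_zero_of_sDegree_eq_zero ha hS,
      m₁, hm₁, m₂, hm₂, hc₁, hc₂, hs₁, hs₂⟩
  · rintro ⟨h, m₁, -, m₂, -, hc₁, hc₂, hs₁, hs₂⟩
    exact ⟨splitsAlong_of_fiberSupportedIn_or ha hS hacc h,
      not_linearIndepOn_of_not_isConnectedComplex hc₁ hs₁,
      not_linearIndepOn_of_not_isConnectedComplex hc₂ hs₂⟩

end ACCP

end Splitting

section Ideals

variable {k : Type*} [Field k] {σ G : Type*} [AddCommGroup G] {a : σ → G} {P : Set σ}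

open MvPolynomial (monomial)

theorem sub_mem_semigroupIdeal_iff {α β : σ →₀ ℕ} :
    monomial α (1 : k) - monomial β 1 ∈ semigroupIdeal k a ↔ sDegree a α = sDegree a β := by
  refine ⟨fun h => ?_, fun h => Ideal.subset_span ⟨α, β, h, rfl⟩⟩
  let φ : MvPolynomial σ k →ₐ[k] AddMonoidAlgebra k G :=
    AddMonoidAlgebra.mapDomainAlgHom k k (Finsupp.linearCombination ℕ a).toAddMonoidHom
  have hφ (α : σ →₀ ℕ) : φ (monomial α 1) = AddMonoidAlgebra.single (sDegree a α) 1 :=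
    AddMonoidAlgebra.mapDomain_single
  have hle : semigroupIdeal k a ≤ RingHom.ker φ := by
    refine Ideal.span_le.2 ?_
    rintro _ ⟨α, β, h, rfl⟩
    rw [SetLike.mem_coe, RingHom.mem_ker, map_sub, hφ, hφ, h, sub_self]
  have hker := hle h
  rw [RingHom.mem_ker, map_sub, hφ, hφ, sub_eq_zero] at hker
  exact AddMonoidAlgebra.single_left_injective one_ne_zero hker

theorem semigroupIdeal_eq_bot_iff : semigroupIdeal k a = ⊥ ↔ LinearIndependent ℕ a := by
  rw [semigroupIdeal, Ideal.span_eq_bot]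
  constructor
  · intro h α β hαβ
    exact MvPolynomial.monomial_left_injective one_ne_zero
      (sub_eq_zero.1 (h _ ⟨α, β, hαβ, rfl⟩))
  · rintro h _ ⟨α, β, hαβ, rfl⟩
    rw [h hαβ, sub_self]

theorem subsemigroupIdeal_ne_bot_iff {B : Set G} :
    subsemigroupIdeal k a B ≠ ⊥ ↔ ¬ LinearIndepOn ℕ a (a ⁻¹' B) :=
  semigroupIdeal_eq_bot_iff.not

theorem extendedSubsemigroupIdeal_eq_span {B : Set G} :
    extendedSubsemigroupIdeal k a B = Ideal.span {p | ∃ α ∈ supported ℕ ℕ (a ⁻¹' B),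
      ∃ β ∈ supported ℕ ℕ (a ⁻¹' B), sDegree a α = sDegree a β ∧
        p = monomial α (1 : k) - monomial β 1} := by
  have hsupported : supported ℕ ℕ (a ⁻¹' B) =
      (Finsupp.lmapDomain ℕ ℕ (Subtype.val : {i // a i ∈ B} → σ)).range := by
    rw [← Submodule.map_top, ← Finsupp.supported_univ, Finsupp.lmapDomain_supported,
      Set.image_univ, Subtype.range_coe_subtype]
    rfl
  rw [extendedSubsemigroupIdeal, subsemigroupIdeal, semigroupIdeal, Ideal.map_span, hsupported]
  congr 1
  ext p
  simp only [Set.mem_image, Set.mem_ofPred_eq, LinearMap.mem_range, Finsupp.lmapDomain_apply,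
    exists_exists_eq_and, sDegree_mapDomain]
  constructor
  · rintro ⟨_, ⟨α, β, hαβ, rfl⟩, rfl⟩
    exact ⟨α, β, hαβ, by simp only [map_sub, MvPolynomial.rename_monomial]⟩
  · rintro ⟨α, β, hαβ, rfl⟩
    exact ⟨_, ⟨α, β, hαβ, rfl⟩, by simp only [map_sub, MvPolynomial.rename_monomial]⟩

theorem extendedSubsemigroupIdeal_le (B : Set G) :
    extendedSubsemigroupIdeal k a B ≤ semigroupIdeal k a := by
  rw [extendedSubsemigroupIdeal_eq_span]
  exact Ideal.span_mono fun p ⟨α, _, β, _, h⟩ => ⟨α, β, h⟩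

theorem eq_zero_of_existsUnique_sum {ι M : Type*} [Fintype ι] [AddCommMonoid M]
    {N : ι → AddSubmonoid M} {x : M} (h : ∃! s : ι → M, (∀ i, s i ∈ N i) ∧ ∑ i, s i = x)
    {i j : ι} (hij : i ≠ j) (hi : x ∈ N i) (hj : x ∈ N j) : x = 0 := by
  classical
  have hsingle (l : ι) (hl : x ∈ N l) :
      (∀ r, (Pi.single l x : ι → M) r ∈ N r) ∧ ∑ r, (Pi.single l x : ι → M) r = x := by
    refine ⟨fun r => ?_, by simp⟩
    obtain rfl | hrl := eq_or_ne r l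
    · rwa [Pi.single_eq_same]
    · rw [Pi.single_eq_of_ne hrl]
      exact zero_mem _
  have heq := congrFun (h.unique (hsingle i hi) (hsingle j hj)) i
  rwa [Pi.single_eq_same, Pi.single_eq_of_ne hij] at heq

theorem splitsAlong_preimage {ι : Type*} {A : ι → Set G}
    (hA : ∀ i j, i ≠ j → Disjoint (a ⁻¹' A i) (a ⁻¹' A j))
    (hideal : semigroupIdeal k a = ⨆ i, extendedSubsemigroupIdeal k a (A i)) (i : ι) :
    SplitsAlong a (a ⁻¹' A i) := by
  intro α β hαβ
  rw [← sub_mem_semigroupIdeal_iff (k := k)] at hαβ ⊢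
  rw [hideal] at hαβ
  refine (iSup_le fun j => ?_ : _ ≤ semigroupIdeal k ((a ⁻¹' A i).indicator a)) hαβ
  rw [extendedSubsemigroupIdeal_eq_span, Ideal.span_le]
  rintro _ ⟨γ, hγ, δ, hδ, hγδ, rfl⟩
  rw [SetLike.mem_coe, sub_mem_semigroupIdeal_iff]
  obtain rfl | hij := eq_or_ne i j
  · rw [sDegree_indicator_of_mem hγ, sDegree_indicator_of_mem hδ, hγδ]
  · have hsub := Finsupp.supported_mono (M := ℕ) (R := ℕ) (hA i j hij).subset_compl_left
    rw [sDegree_indicator_of_mem_compl (hsub hγ), sDegree_indicator_of_mem_compl (hsub hδ)]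

theorem IsDecomposable.exists_splitsAlong (h : IsDecomposable k a) (ha : ∀ i, a i ≠ 0) :
    ∃ P, SplitsAlong a P ∧ ¬ LinearIndepOn ℕ a P ∧ ¬ LinearIndepOn ℕ a Pᶜ := by
  obtain ⟨t, A, ht, -, -, hsum, hideal, hne⟩ := h
  have hdisj (i j : Fin t) (hij : i ≠ j) : Disjoint (a ⁻¹' A i) (a ⁻¹' A j) :=
    Set.disjoint_left.2 fun l hi hj => ha l <|
      eq_zero_of_existsUnique_sum (hsum (a l) (AddSubmonoid.subset_closure ⟨l, rfl⟩)) hij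
        (AddSubmonoid.subset_closure hi) (AddSubmonoid.subset_closure hj)
  obtain ⟨i, j, hij⟩ := (Fin.nontrivial_iff_two_le.2 ht).exists_pair_ne
  refine ⟨a ⁻¹' A i, splitsAlong_preimage hdisj hideal i,
    subsemigroupIdeal_ne_bot_iff.1 (hne i), fun hcompl => ?_⟩
  exact subsemigroupIdeal_ne_bot_iff.1 (hne j) (hcompl.mono (hdisj i j hij).subset_compl_left)

theorem SplitsAlong.closure_image_ne (h : SplitsAlong a P) (ha : ∀ i, a i ≠ 0)
    (hP : Pᶜ.Nonempty) : AddSubmonoid.closure (a '' P) ≠ AddSubmonoid.closure (Set.range a) := by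
  intro heq
  obtain ⟨i, hi⟩ := hP
  have hmem : a i ∈ AddSubmonoid.closure (a '' P) := heq ▸ AddSubmonoid.subset_closure ⟨i, rfl⟩
  obtain ⟨α, hα, hαi⟩ := mem_closure_image_iff.1 hmem
  have hdeg := h α (single i 1) (by rw [hαi, sDegree_single_one])
  rw [sDegree_indicator_of_mem hα, sDegree_single_one, Set.indicator_of_notMem hi, hαi] at hdeg
  exact ha i hdeg

theorem SplitsAlong.existsUnique_sum (h : SplitsAlong a P) {x : G}
    (hx : x ∈ AddSubmonoid.closure (Set.range a)) :
    ∃! s : Fin 2 → G,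
      (∀ i, s i ∈ AddSubmonoid.closure (![a '' P, a '' Pᶜ] i)) ∧ ∑ i, s i = x := by
  simp only [Fin.forall_fin_two, Fin.sum_univ_two, Matrix.cons_val_zero, Matrix.cons_val_one,
    mem_closure_image_iff]
  obtain ⟨α, rfl⟩ := mem_closure_range_iff.1 hx
  obtain ⟨α₁, hα₁, α₂, hα₂, rfl⟩ := exists_add_eq_of_supported_compl P α
  refine ⟨![sDegree a α₁, sDegree a α₂],
    ⟨⟨⟨α₁, hα₁, rfl⟩, α₂, hα₂, rfl⟩, (sDegree_add a α₁ α₂).symm⟩, ?_⟩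
  rintro s ⟨⟨⟨β₁, hβ₁, h₁⟩, β₂, hβ₂, h₂⟩, hsum⟩
  rw [← h₁, ← h₂, ← sDegree_add] at hsum
  obtain ⟨hdeg₁, hdeg₂⟩ := h.sDegree_eq_and_eq hβ₁ hβ₂ hα₁ hα₂ hsum
  exact funext (Fin.forall_fin_two.2 ⟨h₁.symm.trans hdeg₁, h₂.symm.trans hdeg₂⟩)

theorem SplitsAlong.semigroupIdeal_eq_sup (h : SplitsAlong a P) :
    semigroupIdeal k a =
      extendedSubsemigroupIdeal k a (a '' P) ⊔ extendedSubsemigroupIdeal k a (a '' Pᶜ) := by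
  refine le_antisymm (Ideal.span_le.2 ?_)
    (sup_le (extendedSubsemigroupIdeal_le _) (extendedSubsemigroupIdeal_le _))
  rintro _ ⟨α, β, hαβ, rfl⟩
  obtain ⟨α₁, hα₁, α₂, hα₂, rfl⟩ := exists_add_eq_of_supported_compl P α
  obtain ⟨β₁, hβ₁, β₂, hβ₂, rfl⟩ := exists_add_eq_of_supported_compl P β
  obtain ⟨hdeg₁, hdeg₂⟩ := h.sDegree_eq_and_eq hα₁ hα₂ hβ₁ hβ₂ hαβ
  have hmem {Q : Set σ} {γ δ : σ →₀ ℕ} (hγ : γ ∈ supported ℕ ℕ Q) (hδ : δ ∈ supported ℕ ℕ Q)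
      (hγδ : sDegree a γ = sDegree a δ) :
      monomial γ (1 : k) - monomial δ 1 ∈ extendedSubsemigroupIdeal k a (a '' Q) := by
    have hle := Finsupp.supported_mono (M := ℕ) (R := ℕ) (Set.subset_preimage_image a Q)
    rw [extendedSubsemigroupIdeal_eq_span]
    exact Ideal.subset_span ⟨γ, hle hγ, δ, hle hδ, hγδ, rfl⟩
  have hexpand : monomial (α₁ + α₂) (1 : k) - monomial (β₁ + β₂) 1 =
      monomial α₂ 1 * (monomial α₁ 1 - monomial β₁ 1) +
        monomial β₁ 1 * (monomial α₂ 1 - monomial β₂ 1) := by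
    rw [← one_mul (1 : k), ← MvPolynomial.monomial_mul, ← MvPolynomial.monomial_mul, one_mul]
    ring
  rw [SetLike.mem_coe, hexpand]
  exact add_mem (Ideal.mul_mem_left _ _ (Ideal.mem_sup_left (hmem hα₁ hβ₁ hdeg₁)))
    (Ideal.mul_mem_left _ _ (Ideal.mem_sup_right (hmem hα₂ hβ₂ hdeg₂)))

theorem nonempty_of_not_linearIndepOn (h : ¬ LinearIndepOn ℕ a P) : P.Nonempty := by
  contrapose! h
  exact h ▸ linearIndepOn_empty ℕ a

theorem SplitsAlong.isDecomposable (h : SplitsAlong a P) (ha : ∀ i, a i ≠ 0)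
    (hP : ¬ LinearIndepOn ℕ a P) (hPc : ¬ LinearIndepOn ℕ a Pᶜ) : IsDecomposable k a := by
  refine ⟨2, ![a '' P, a '' Pᶜ], le_rfl, ?_, ?_, fun x => h.existsUnique_sum, ?_, ?_⟩
  · exact Fin.forall_fin_two.2 ⟨Set.image_subset_range a P, Set.image_subset_range a Pᶜ⟩
  · refine Fin.forall_fin_two.2 ⟨h.closure_image_ne ha (nonempty_of_not_linearIndepOn hPc),
      h.compl.closure_image_ne ha ?_⟩
    rw [compl_compl]
    exact nonempty_of_not_linearIndepOn hP
  · rw [h.semigroupIdeal_eq_sup]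
    exact eq_of_forall_ge_iff fun J => by simp [Fin.forall_fin_two]
  · simp only [Fin.forall_fin_two, Matrix.cons_val_zero, Matrix.cons_val_one,
      subsemigroupIdeal_ne_bot_iff, h.preimage_image ha, h.compl.preimage_image ha]
    exact ⟨hP, hPc⟩

end Ideals

section Decomposability

variable {k : Type*} [Field k] {σ G : Type*} [AddCommGroup G] {a : σ → G} {P : Set σ}

theorem SeparatesDisconnected.nonempty (h : SeparatesDisconnected a P) : P.Nonempty := by
  obtain ⟨-, m, -, -, -, hm, -, hmP, -⟩ := h
  exact nonempty_of_not_linearIndepOn (not_linearIndepOn_of_not_isConnectedComplex hm hmP)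

theorem SeparatesDisconnected.nonempty_compl (h : SeparatesDisconnected a P) : Pᶜ.Nonempty := by
  obtain ⟨-, -, -, m, -, -, hm, -, hmP⟩ := h
  exact nonempty_of_not_linearIndepOn (not_linearIndepOn_of_not_isConnectedComplex hm hmP)

theorem exists_separatesDisconnected_iff_deltaComplex :
    (∃ P, SeparatesDisconnected a P) ↔
      ∃ C₁ C₂ : Set σ, C₁ ⊂ Set.univ ∧ C₂ ⊂ Set.univ ∧ Disjoint C₁ C₂ ∧
        Set.univ = C₁ ∪ C₂ ∧
        (∀ m ∈ AddSubmonoid.closure (Set.range a), ¬ IsConnectedComplex (deltaComplex a m) →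
          complexVertices (deltaComplex a m) ⊆ C₁ ∨ complexVertices (deltaComplex a m) ⊆ C₂) ∧
        ∃ m₁ ∈ AddSubmonoid.closure (Set.range a), ∃ m₂ ∈ AddSubmonoid.closure (Set.range a),
          ¬ IsConnectedComplex (deltaComplex a m₁) ∧ ¬ IsConnectedComplex (deltaComplex a m₂) ∧
          complexVertices (deltaComplex a m₁) ⊆ C₁ ∧ complexVertices (deltaComplex a m₂) ⊆ C₂ := by
  simp only [complexVertices_deltaComplex_subset_iff,
    ← isConnectedComplex_nablaComplex_iff_deltaComplex]
  constructor
  · rintro ⟨P, hP⟩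
    exact ⟨P, Pᶜ, Set.ssubset_univ_iff.2 (Set.nonempty_compl.1 hP.nonempty_compl),
      Set.ssubset_univ_iff.2 (Set.compl_ne_univ.2 hP.nonempty), disjoint_compl_right,
      (Set.union_compl_self P).symm, hP⟩
  · rintro ⟨P, Q, -, -, hdisj, hunion, h⟩
    obtain rfl : Pᶜ = Q := (IsCompl.of_eq hdisj.eq_bot hunion.symm).compl_eq
    exact ⟨P, h⟩

section ACCP

variable (ha : ∀ i, a i ≠ 0)
  (hS : ∀ x ∈ AddSubmonoid.closure (Set.range a),
    -x ∈ AddSubmonoid.closure (Set.range a) → x = 0)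
  (hacc : SatisfiesACCP (AddSubmonoid.closure (Set.range a)))

include ha hS hacc

theorem isDecomposable_iff_exists_separatesDisconnected :
    IsDecomposable k a ↔ ∃ P, SeparatesDisconnected a P := by
  simp only [← splitsAlong_and_iff_separatesDisconnected ha hS hacc]
  exact ⟨fun h => h.exists_splitsAlong ha, fun ⟨_, h, hP, hPc⟩ => h.isDecomposable ha hP hPc⟩

theorem exists_separatesDisconnected_iff_nablaComplex :
    (∃ P, SeparatesDisconnected a P) ↔
      ∃ C₁ C₂ : Set G, C₁ ⊂ Set.range a ∧ C₂ ⊂ Set.range a ∧ Disjoint C₁ C₂ ∧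
        Set.range a = C₁ ∪ C₂ ∧
        (∀ m ∈ AddSubmonoid.closure (Set.range a), ¬ IsConnectedComplex (nablaComplex a m) →
          NablaVerticesIn k a m C₁ ∨ NablaVerticesIn k a m C₂) ∧
        ∃ m₁ ∈ AddSubmonoid.closure (Set.range a), ∃ m₂ ∈ AddSubmonoid.closure (Set.range a),
          ¬ IsConnectedComplex (nablaComplex a m₁) ∧ ¬ IsConnectedComplex (nablaComplex a m₂) ∧
          NablaVerticesIn k a m₁ C₁ ∧ NablaVerticesIn k a m₂ C₂ := by
  simp only [nablaVerticesIn_iff]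
  constructor
  · rintro ⟨P, hP⟩
    have hsplit := ((splitsAlong_and_iff_separatesDisconnected ha hS hacc).2 hP).1
    have hpre := hsplit.preimage_image ha
    have hpre' := hsplit.compl.preimage_image ha
    obtain ⟨i, hi⟩ := hP.nonempty
    obtain ⟨j, hj⟩ := hP.nonempty_compl
    refine ⟨a '' P, a '' Pᶜ, ?_, ?_, ?_, ?_, by rw [hpre, hpre']; exact hP⟩
    · exact ⟨Set.image_subset_range a P, fun h => hj (hpre.subset (h ⟨j, rfl⟩))⟩
    · exact ⟨Set.image_subset_range a Pᶜ, fun h => hpre'.subset (h ⟨i, rfl⟩) hi⟩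
    · rw [Set.disjoint_image_left, hpre']
      exact disjoint_compl_right
    · rw [← Set.image_union, Set.union_compl_self, Set.image_univ]
  · rintro ⟨C₁, C₂, -, -, hdisj, hunion, h⟩
    have hcover : a ⁻¹' C₁ ∪ a ⁻¹' C₂ = Set.univ := by
      rw [← Set.preimage_union, ← hunion, Set.preimage_range]
    have hcompl : a ⁻¹' C₂ = (a ⁻¹' C₁)ᶜ :=
      (IsCompl.of_eq (hdisj.preimage a).eq_bot hcover).compl_eq.symm
    rw [hcompl] at h
    exact ⟨_, h⟩

end ACCP

end Decomposability

theorem theorem6p1_general {k G σ : Type*} [Field k] [AddCommGroup G] (a : σ → G)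
    (ha : ∀ i, a i ≠ 0)
    (hS : ∀ x ∈ AddSubmonoid.closure (Set.range a),
      -x ∈ AddSubmonoid.closure (Set.range a) → x = 0)
    (hacc : SatisfiesACCP (AddSubmonoid.closure (Set.range a))) :
    List.TFAE [
      IsDecomposable k a,
      ∃ C₁ C₂ : Set G, C₁ ⊂ Set.range a ∧ C₂ ⊂ Set.range a ∧ Disjoint C₁ C₂ ∧
        Set.range a = C₁ ∪ C₂ ∧
        (∀ m ∈ AddSubmonoid.closure (Set.range a), ¬ IsConnectedComplex (nablaComplex a m) →
          NablaVerticesIn k a m C₁ ∨ NablaVerticesIn k a m C₂) ∧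
        ∃ m₁ ∈ AddSubmonoid.closure (Set.range a), ∃ m₂ ∈ AddSubmonoid.closure (Set.range a),
          ¬ IsConnectedComplex (nablaComplex a m₁) ∧ ¬ IsConnectedComplex (nablaComplex a m₂) ∧
          NablaVerticesIn k a m₁ C₁ ∧ NablaVerticesIn k a m₂ C₂,
      ∃ C₁ C₂ : Set σ, C₁ ⊂ Set.univ ∧ C₂ ⊂ Set.univ ∧ Disjoint C₁ C₂ ∧
        Set.univ = C₁ ∪ C₂ ∧
        (∀ m ∈ AddSubmonoid.closure (Set.range a), ¬ IsConnectedComplex (deltaComplex a m) →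
          complexVertices (deltaComplex a m) ⊆ C₁ ∨ complexVertices (deltaComplex a m) ⊆ C₂) ∧
        ∃ m₁ ∈ AddSubmonoid.closure (Set.range a), ∃ m₂ ∈ AddSubmonoid.closure (Set.range a),
          ¬ IsConnectedComplex (deltaComplex a m₁) ∧ ¬ IsConnectedComplex (deltaComplex a m₂) ∧
          complexVertices (deltaComplex a m₁) ⊆ C₁ ∧ complexVertices (deltaComplex a m₂) ⊆ C₂] := by
  tfae_have 1 ↔ 2 :=
    (isDecomposable_iff_exists_separatesDisconnected ha hS hacc).trans
      (exists_separatesDisconnected_iff_nablaComplex ha hS hacc)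
  tfae_have 1 ↔ 3 :=
    (isDecomposable_iff_exists_separatesDisconnected ha hS hacc).trans
      exists_separatesDisconnected_iff_deltaComplex
  tfae_finish

theorem theorem6p1 {k G : Type*} [Field k] [AddCommGroup G] {n : ℕ} (a : Fin n → G)
    (ha : ∀ i, a i ≠ 0)
    (hS : ∀ x ∈ AddSubmonoid.closure (Set.range a),
      -x ∈ AddSubmonoid.closure (Set.range a) → x = 0) :
    List.TFAE [
      IsDecomposable k a,
      ∃ C₁ C₂ : Set G, C₁ ⊂ Set.range a ∧ C₂ ⊂ Set.range a ∧ Disjoint C₁ C₂ ∧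
        Set.range a = C₁ ∪ C₂ ∧
        (∀ m ∈ AddSubmonoid.closure (Set.range a), ¬ IsConnectedComplex (nablaComplex a m) →
          NablaVerticesIn k a m C₁ ∨ NablaVerticesIn k a m C₂) ∧
        ∃ m₁ ∈ AddSubmonoid.closure (Set.range a), ∃ m₂ ∈ AddSubmonoid.closure (Set.range a),
          ¬ IsConnectedComplex (nablaComplex a m₁) ∧ ¬ IsConnectedComplex (nablaComplex a m₂) ∧
          NablaVerticesIn k a m₁ C₁ ∧ NablaVerticesIn k a m₂ C₂,
      ∃ C₁ C₂ : Set (Fin n), C₁ ⊂ Set.univ ∧ C₂ ⊂ Set.univ ∧ Disjoint C₁ C₂ ∧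
        Set.univ = C₁ ∪ C₂ ∧
        (∀ m ∈ AddSubmonoid.closure (Set.range a), ¬ IsConnectedComplex (deltaComplex a m) →
          complexVertices (deltaComplex a m) ⊆ C₁ ∨ complexVertices (deltaComplex a m) ⊆ C₂) ∧
        ∃ m₁ ∈ AddSubmonoid.closure (Set.range a), ∃ m₂ ∈ AddSubmonoid.closure (Set.range a),
          ¬ IsConnectedComplex (deltaComplex a m₁) ∧ ¬ IsConnectedComplex (deltaComplex a m₂) ∧
          complexVertices (deltaComplex a m₁) ⊆ C₁ ∧ complexVertices (deltaComplex a m₂) ⊆ C₂] :=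
  theorem6p1_general a ha hS <|
    satisfiesACCP_of_fg ((AddSubmonoid.fg_iff _).2 ⟨_, rfl, Set.finite_range a⟩)
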